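/- Let $1\le p\le q$ be integers, equip $\mathbb R^{p+q}$ with its standard scalar product, and let $\mathrm{Gr}_{p,q}$ be the set of all $p$-dimensional linear subspaces of $\mathbb R^{p+q}$, on which the orthogonal group $\mathrm O(p+q)$ acts by $(g,L)\mapsto gL$. For $L,M\in\mathrm{Gr}_{p,q}$ choose orthonormal bases $e_1,\dots,e_p$ of $L$ and $f_1,\dots,f_p$ of $M$, let $\lambda_1\ge\dots\ge\lambda_p$ be the singular values of the $p\times p$ matrix $(\langle e_i,f_j\rangle)_{i,j}$ (they do not depend on the choice of the bases), and let $\Psi_j[L,M]=\arccos\lambda_j\in[0,\pi/2]$ be the angles between $L$ and $M$. Let $W_p$ be the group of transformations of $\mathbb R^p$ generated by the permutations of the coordinates and the sign changes $(t_1,\dots,t_p)\mapsto(\sigma_1t_1,\dots,\sigma_pt_p)$, $\sigma_j=\pm1$. Theorem A. For every $W_p$-invariant norm $\ell$ on $\mathbb R^p$, the function $$d(L,M)=\ell(\Psi_1[L,M],\dots,\Psi_p[L,M])$$ is an $\mathrm O(p+q)$-invariant metric on $\mathrm{Gr}_{p,q}$: it is a metric, and $d(gL,gM)=d(L,M)$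 for all $g\in\mathrm O(p+q)$ and $L,M\in\mathrm{Gr}_{p,q}$. -/

import Mathlib

/-- The Euclidean space `ℝ^(p+q)` with its standard scalar product. -/
abbrev Ambient (p q : ℕ) : Type := EuclideanSpace ℝ (Fin (p + q))

/-- The Grassmannian `Gr_{p,q}` of all `p`-dimensional linear subspaces of `ℝ^(p+q)`. -/
def Gr (p q : ℕ) : Type :=
  {L : Submodule ℝ (Ambient p q) // Module.finrank ℝ L = p}

namespace Gr

variable {p q : ℕ}

/-- The orthogonal group `O(p+q)` of linear isometries of `ℝ^(p+q)`. -/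
abbrev OrthogonalGroup (p q : ℕ) : Type := Ambient p q ≃ₗᵢ[ℝ] Ambient p q

/-- The action of `O(p+q)` on the Grassmannian: `g L` is the image of `L` under `g`. -/
noncomputable def act (g : OrthogonalGroup p q) (L : Gr p q) : Gr p q :=
  ⟨L.1.map (g.toLinearEquiv : Ambient p q →ₗ[ℝ] Ambient p q), by
    rw [LinearEquiv.finrank_map_eq]; exact L.2⟩

/-- The matrix `Λ` with the elements `⟨e_i, f_j⟩`, for orthonormal bases `e` of `L`, `f` of `M`. -/
noncomputable def crossGram {L M : Gr p q} (e : OrthonormalBasis (Fin p) ℝ L.1)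
    (f : OrthonormalBasis (Fin p) ℝ M.1) : Matrix (Fin p) (Fin p) ℝ :=
  Matrix.of fun i j => inner ℝ (e i : Ambient p q) (f j : Ambient p q)

/-- Some orthonormal basis of a `p`-dimensional subspace. -/
noncomputable def onb (L : Gr p q) : OrthonormalBasis (Fin p) ℝ L.1 :=
  (stdOrthonormalBasis ℝ L.1).reindex (finCongr L.2)

/-- `lam L M j` (for `j = 0, …, p - 1`) is the `j`-th singular value, in decreasing order,
of the matrix `Λ[L, M]`, computed in some orthonormal bases of `L` and `M`; see
`lam_eq` for the independence of the choice of bases. -/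
noncomputable def lam (L M : Gr p q) (j : Fin p) : ℝ :=
  (Matrix.toEuclideanLin (crossGram L.onb M.onb)).singularValues j

/-- The angles `Ψ_j[L, M] = arccos λ_j[L, M]`, in increasing order. -/
noncomputable def angles (L M : Gr p q) : Fin p → ℝ :=
  fun j => Real.arccos (lam L M j)

theorem inner_crossGram {L M : Gr p q} (e e' : OrthonormalBasis (Fin p) ℝ L.1)
    (f f' : OrthonormalBasis (Fin p) ℝ M.1) (x y : M.1) :
    inner ℝ (Matrix.toEuclideanLin (crossGram e f) (f.repr x))
        (Matrix.toEuclideanLin (crossGram e f) (f.repr y)) =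
      inner ℝ (Matrix.toEuclideanLin (crossGram e' f') (f'.repr x))
        (Matrix.toEuclideanLin (crossGram e' f') (f'.repr y)) := by
  have key : ∀ (e : OrthonormalBasis (Fin p) ℝ L.1) (f : OrthonormalBasis (Fin p) ℝ M.1)
      (x : M.1), Matrix.toEuclideanLin (crossGram e f) (f.repr x) =
        e.repr (L.1.orthogonalProjectionOnto (x : Ambient p q)) := by
    intro e f x
    ext i
    have h1 : (x : Ambient p q) = ∑ j, f.repr x j • (f j : Ambient p q) := by
      conv_lhs => rw [← f.sum_repr x]
      simp
    rw [e.repr_apply_apply, Submodule.inner_orthogonalProjectionOnto_eq_of_mem_left, h1, inner_sum]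
    simp [Matrix.toLpLin_apply, Matrix.mulVec, dotProduct, crossGram, inner_smul_right, mul_comm]
  rw [key, key, key, key, LinearIsometryEquiv.inner_map_map, LinearIsometryEquiv.inner_map_map]

/-- The numbers `λ_j[L, M]` do not depend on the choice of orthonormal bases. -/
theorem lam_eq {L M : Gr p q} (e : OrthonormalBasis (Fin p) ℝ L.1)
    (f : OrthonormalBasis (Fin p) ℝ M.1) (j : Fin p) :
    lam L M j = (Matrix.toEuclideanLin (crossGram e f)).singularValues j := by
  have hn : Module.finrank ℝ (EuclideanSpace ℝ (Fin p)) = p := by simp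
  rw [lam, LinearMap.singularValues_fin _ hn, LinearMap.singularValues_fin _ hn]
  congr 1
  refine congrFun ((LinearMap.IsSymmetric.eigenvalues_eq_eigenvalues_iff _ _ _ _).2 ?_) j
  rw [← LinearEquiv.charpoly_conj (M.onb.repr.symm.trans f.repr).toLinearEquiv
    (LinearMap.adjoint (Matrix.toEuclideanLin (crossGram L.onb M.onb)) ∘ₗ _)]
  congr 1
  refine LinearMap.ext fun z => ?_
  refine ext_inner_right ℝ fun w => ?_
  obtain ⟨x, rfl⟩ := f.repr.surjective z
  obtain ⟨y, rfl⟩ := f.repr.surjective w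
  have h := inner_crossGram L.onb e M.onb f x y
  rw [LinearMap.comp_apply, LinearMap.adjoint_inner_left, ← h]
  have h2 : ∀ a : EuclideanSpace ℝ (Fin p),
      inner ℝ ((M.onb.repr.symm.trans f.repr) a) (f.repr y) = inner ℝ a (M.onb.repr y) := by
    intro a
    obtain ⟨b, rfl⟩ := M.onb.repr.surjective a
    simp
  rw [← LinearMap.adjoint_inner_left, ← h2]
  simp [LinearEquiv.conj_apply]

end Gr

/-- The group `W_p` of transformations of `ℝ^p` generated by the permutations of the coordinates
and by the sign changes `(t_1, …, t_p) ↦ (σ_1 t_1, …, σ_p t_p)`, `σ_j = ±1`. -/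
def weylGroup (p : ℕ) : Subgroup (Equiv.Perm (Fin p → ℝ)) :=
  Subgroup.closure
    ({w | ∃ s : Equiv.Perm (Fin p), ∀ t j, w t j = t (s j)} ∪
      {w | ∃ σ : Fin p → ℝ, (∀ j, σ j = 1 ∨ σ j = -1) ∧ ∀ t j, w t j = σ j * t j})

/-! The main point is the triangle inequality. Write `S_k` for the sum of the `k` largest principal
angles. A Weyl-invariant norm is monotone under weak majorization
(`weylInvariant_le_of_tail_sums_le`), and the angles are already sorted, so it is enough that each
`S_k` satisfies the triangle inequality (`IsPrincipalSystem.sum_natAdd_arccos_le_add`).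

To bound `S_k` of `L`, `N`, let `U ≤ L` be the span of the `k` principal vectors of `L` with the
largest angles to `N`; Cauchy interlacing (`IsPrincipalSystem.le_of_le`) bounds the sum of all angles
between `U` and `M` by `S_k` of `L`, `M`. Now let `M` move to `N` along the geodesic which rotates
each principal vector of `M` to its partner in `N` with constant speed `θ_i`, the `i`-th angle
between `M` and `N`. The sum of the angles to `U` grows at most at the rate `S_k(θ)`
(`IsPrincipalSystem.sum_arccos_le_add`). Two facts yield this. The sum of the angles is the minimum of
`∑ arccos |⟨x_j, y_j⟩|` over paired orthonormal bases (`IsPrincipalSystem.sum_arccos_le`), so the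
principal pairs at one time, transported along the geodesic, bound the sum at a later time. And the
first-order change of this bound is `∑ θ_i b_i`, where the coefficients satisfy `|b_i| ≤ 1` and
`∑ |b_i| ≤ k` by Bessel's inequality, because the components of the principal vectors of `U`
orthogonal to the moving subspace are themselves orthogonal. No differentiation of singular values is
needed: `arccos` is concave on `[0, 1]`, which gives the first-order bound directly. Its singularity
at `1` is avoided by replacing `arccos s` with `arccos (ρ s)`, `ρ < 1`, and letting `ρ` tend to `1`.

The singular values are handled through `IsPrincipalSystem`, whose uniqueness
(`IsPrincipalSystem.unique`) also gives the symmetry and the orthogonal invariance. -/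

/-! ### Weyl-invariant norms and weak majorization -/

theorem sum_mul_nonneg_of_tail_sums_nonneg {p : ℕ} (w x : Fin p → ℝ) (hw : Monotone w)
    (hw0 : ∀ j, 0 ≤ w j) (hx : ∀ m : ℕ, 0 ≤ ∑ j : Fin p, if m ≤ (j : ℕ) then x j else 0) :
    0 ≤ ∑ j, w j * x j := by
  induction p with
  | zero => simp
  | succ p ih =>
    have h := ih (fun j => w j.succ - w 0) (fun j => x j.succ)
      (fun i j hij => sub_le_sub_right (hw (Fin.succ_le_succ_iff.2 hij)) _)
      (fun j => sub_nonneg.2 (hw (Fin.zero_le _)))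
      (fun m => by simpa [Fin.sum_univ_succ] using hx (m + 1))
    have h0 : 0 ≤ ∑ j, x j := by simpa using hx 0
    have e : ∑ j, w j * x j = w 0 * ∑ j, x j + ∑ j : Fin p, (w j.succ - w 0) * x j.succ := by
      simp only [Fin.sum_univ_succ, mul_add, Finset.mul_sum, sub_mul, Finset.sum_sub_distrib]
      ring
    rw [e]
    exact add_nonneg (mul_nonneg (hw0 0) h0) h

/-- The signed permutation `t ↦ (σ_j t_{s j})_j` preserves a Weyl-invariant seminorm. -/
theorem weylInvariant_apply_signed_perm {p : ℕ} (ℓ : Seminorm ℝ (Fin p → ℝ))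
    (hW : ∀ w ∈ weylGroup p, ∀ x, ℓ (w x) = ℓ x) (s : Equiv.Perm (Fin p)) (σ : Fin p → ℝ)
    (hσ : ∀ j, σ j = 1 ∨ σ j = -1) (t : Fin p → ℝ) :
    ℓ (fun j => σ j * t (s j)) = ℓ t := by
  have hinv : Function.Involutive fun (t : Fin p → ℝ) j => σ j * t j := fun t => by
    funext j
    rcases hσ j with h | h <;> simp [h]
  have h1 := hW (hinv.toPerm _) (Subgroup.subset_closure (Or.inr ⟨σ, hσ, fun _ _ => rfl⟩))
    (fun j => t (s j))
  have h2 := hW (Equiv.arrowCongr s.symm (Equiv.refl ℝ))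
    (Subgroup.subset_closure (Or.inl ⟨s, fun _ _ => rfl⟩)) t
  exact h1.trans h2

/-- Weyl-invariant seminorms are monotone under weak majorization: a norming functional `c` of `x`
satisfies `c x ≤ ∑ |c|_{s j} x_j` by the rearrangement inequality, where `s` sorts `|c|`, and
Abel summation compares the right-hand side with the value of `c` on a signed permutation
of `y`. -/
theorem weylInvariant_le_of_tail_sums_le {p : ℕ} (ℓ : Seminorm ℝ (Fin p → ℝ))
    (hW : ∀ w ∈ weylGroup p, ∀ x, ℓ (w x) = ℓ x) (x y : Fin p → ℝ) (hx : Monotone x)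
    (hx0 : ∀ j, 0 ≤ x j)
    (hxy : ∀ m : ℕ, (∑ j : Fin p, if m ≤ (j : ℕ) then x j else 0) ≤
      ∑ j : Fin p, if m ≤ (j : ℕ) then y j else 0) :
    ℓ x ≤ ℓ y := by
  obtain ⟨g, hgx, hg⟩ : ∃ g : Module.Dual ℝ (Fin p → ℝ), g x = ℓ x ∧ ∀ z, |g z| ≤ ℓ z := by
    by_cases h : x = 0
    · exact ⟨0, by simp [h], by simp⟩
    obtain ⟨g, h1, h2⟩ := Module.Dual.exists_extension_of_le_seminorm_real (p := ℓ)
      (Submodule.span ℝ {x})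
      ((ℓ x) • (LinearEquiv.toSpanNonzeroSingleton ℝ (Fin p → ℝ) x h).symm.toLinearMap) (by
        intro z
        obtain ⟨a, rfl⟩ := (LinearEquiv.toSpanNonzeroSingleton ℝ (Fin p → ℝ) x h).surjective z
        have : ((LinearEquiv.toSpanNonzeroSingleton ℝ (Fin p → ℝ) x h a :
          Submodule.span ℝ {x}) : Fin p → ℝ) = a • x := rfl
        simp only [LinearMap.smul_apply, LinearEquiv.coe_coe, LinearEquiv.symm_apply_apply,
          smul_eq_mul, this, map_smul_eq_mul, Real.norm_eq_abs]
        nlinarith [le_abs_self a, apply_nonneg ℓ x])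
    refine ⟨g, ?_, h2⟩
    have := h1 (LinearEquiv.toSpanNonzeroSingleton ℝ (Fin p → ℝ) x h 1)
    rw [LinearMap.smul_apply, LinearEquiv.coe_coe, LinearEquiv.symm_apply_apply, smul_eq_mul,
      mul_one] at this
    exact (congrArg g (one_smul ℝ x)).symm.trans this
  set c : Fin p → ℝ := fun j => g (Pi.single j 1) with hc
  have hgc : ∀ z, g z = ∑ j, c j * z j := fun z => by
    conv_lhs => rw [← Finset.univ_sum_single z]
    rw [map_sum]
    refine Finset.sum_congr rfl fun j _ => ?_
    have : Pi.single j (z j) = z j • (Pi.single j 1 : Fin p → ℝ) := by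
      rw [← Pi.single_smul]; simp
    rw [this, map_smul, smul_eq_mul, mul_comm]
  set s := Tuple.sort fun j => |c j|
  have hs : Monotone fun j => |c (s j)| := Tuple.monotone_sort fun j => |c j|
  have h1 : ℓ x ≤ ∑ j, |c j| * x j := by
    rw [← hgx, hgc]
    exact Finset.sum_le_sum fun j _ => mul_le_mul_of_nonneg_right (le_abs_self _) (hx0 j)
  have h2 : ∑ j, |c j| * x j ≤ ∑ j, |c (s j)| * x j := by
    have := (hs.monovary hx).sum_comp_perm_mul_le_sum_mul (σ := s⁻¹)
    simpa using this
  have h3 : ∑ j, |c (s j)| * x j ≤ ∑ j, |c (s j)| * y j := by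
    have := sum_mul_nonneg_of_tail_sums_nonneg (fun j => |c (s j)|) (fun j => y j - x j) hs
      (fun j => abs_nonneg _) (fun m => by
        have := sub_nonneg.2 (hxy m)
        rw [← Finset.sum_sub_distrib] at this
        refine this.trans (le_of_eq (Finset.sum_congr rfl fun j _ => ?_))
        split_ifs <;> simp)
    simp only [mul_sub, Finset.sum_sub_distrib] at this
    linarith
  set σ : Fin p → ℝ := fun j => if 0 ≤ c j then 1 else -1
  have h4 : ∑ j, |c (s j)| * y j = g (fun j => σ j * y (s⁻¹ j)) := by
    rw [hgc, ← Equiv.sum_comp s fun j => c j * (σ j * y (s⁻¹ j))]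
    refine Finset.sum_congr rfl fun j _ => ?_
    rw [show s⁻¹ (s j) = j from s.symm_apply_apply j]
    by_cases h : 0 ≤ c (s j)
    · simp [σ, h]
    · simp [σ, h, abs_of_neg (not_le.1 h)]
  have h5 := weylInvariant_apply_signed_perm ℓ hW s⁻¹ σ
    (fun j => by by_cases h : 0 ≤ c j <;> simp [σ, h]) y
  have h6 := (le_abs_self _).trans (hg (fun j => σ j * y (s⁻¹ j)))
  linarith

/-- A linear functional with weights in `[0, 1]` of total mass at most `k` is largest on an
increasing sequence when it sums the last `k` terms. -/
theorem sum_mul_le_sum_natAdd {m k : ℕ} (θ b : Fin (m + k) → ℝ) (hθ : Monotone θ)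
    (hθ0 : ∀ i, 0 ≤ θ i) (hb0 : ∀ i, 0 ≤ b i) (hb1 : ∀ i, b i ≤ 1) (hb : ∑ i, b i ≤ k) :
    ∑ i, θ i * b i ≤ ∑ j : Fin k, θ (Fin.natAdd m j) := by
  rcases Nat.eq_zero_or_pos k with rfl | hk
  · have h : ∀ i, b i = 0 := fun i =>
      (Finset.sum_eq_zero_iff_of_nonneg fun i _ => hb0 i).1
        (le_antisymm (by simpa using hb) (Finset.sum_nonneg fun i _ => hb0 i)) i
          (Finset.mem_univ i)
    simp [h]
  set c := θ (Fin.natAdd m ⟨0, hk⟩)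
  rw [Fin.sum_univ_add] at hb ⊢
  have h1 : ∑ i : Fin m, θ (Fin.castAdd k i) * b (Fin.castAdd k i) ≤
      ∑ i : Fin m, c * b (Fin.castAdd k i) :=
    Finset.sum_le_sum fun i _ => mul_le_mul_of_nonneg_right
      (hθ (Fin.le_def.2 (by simp))) (hb0 _)
  have h2 : ∑ j : Fin k, (θ (Fin.natAdd m j) * b (Fin.natAdd m j) +
      c * (1 - b (Fin.natAdd m j))) ≤ ∑ j : Fin k, θ (Fin.natAdd m j) :=
    Finset.sum_le_sum fun j _ => by
      have : c ≤ θ (Fin.natAdd m j) := hθ (Fin.le_def.2 (by simp))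
      nlinarith [hb1 (Fin.natAdd m j)]
  simp only [Finset.sum_add_distrib, ← Finset.mul_sum, Finset.sum_sub_distrib] at h1 h2
  simp only [Finset.sum_const, Finset.card_univ, Fintype.card_fin, nsmul_eq_mul, mul_one] at h2
  nlinarith [hθ0 (Fin.natAdd m ⟨0, hk⟩)]

/-! ### Concavity of the arc cosine on the unit interval -/

theorem cos_le_cos_sub_sin_mul_sub {α β : ℝ} (hα : α ∈ Set.Icc 0 (Real.pi / 2))
    (hβ : β ∈ Set.Icc 0 (Real.pi / 2)) :
    Real.cos α ≤ Real.cos β - Real.sin β * (α - β) := by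
  have hsub : Set.Icc 0 (Real.pi / 2) ⊆ Set.Icc (-(Real.pi / 2)) (Real.pi / 2) :=
    Set.Icc_subset_Icc_left (by linarith [Real.pi_pos])
  have hc := strictConcaveOn_cos_Icc.concaveOn
  rcases lt_trichotomy α β with h | rfl | h
  · have := hc.le_slope_of_hasDerivAt (hsub hα) (hsub hβ) h (Real.hasDerivAt_cos β)
    rw [slope_def_field, le_div_iff₀ (by linarith)] at this
    linarith
  · simp
  · have := hc.slope_le_of_hasDerivAt (hsub hβ) (hsub hα) h (Real.hasDerivAt_cos β)
    rw [slope_def_field, div_le_iff₀ (by linarith)] at this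
    linarith

theorem arccos_mem_Icc_zero_pi_div_two {a : ℝ} (ha : 0 ≤ a) :
    Real.arccos a ∈ Set.Icc 0 (Real.pi / 2) :=
  ⟨Real.arccos_nonneg a, Real.arccos_le_pi_div_two.2 ha⟩

theorem arccos_le_sub_div_sqrt {a b : ℝ} (ha : 0 ≤ a) (ha1 : a ≤ 1) (hb : 0 ≤ b) (hb1 : b < 1) :
    Real.arccos a ≤ Real.arccos b - (a - b) / √(1 - b ^ 2) := by
  have h := cos_le_cos_sub_sin_mul_sub (arccos_mem_Icc_zero_pi_div_two ha)
    (arccos_mem_Icc_zero_pi_div_two hb)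
  rw [Real.cos_arccos (by linarith) ha1, Real.cos_arccos (by linarith) hb1.le,
    Real.sin_arccos] at h
  have hs : 0 < √(1 - b ^ 2) := Real.sqrt_pos.2 (by nlinarith)
  have : (a - b) / √(1 - b ^ 2) ≤ Real.arccos b - Real.arccos a := by
    rw [div_le_iff₀ hs]; linarith
  linarith

/-- Jensen's inequality for `arccos` with weights of total mass at most one, the missing mass being
placed at `arccos 0 = π / 2`. -/
theorem sum_mul_arccos_le_arccos_sum {ι : Type*} [Fintype ι] (D r : ι → ℝ) (hD : ∀ i, 0 ≤ D i)
    (hD1 : ∑ i, D i ≤ 1) (hr : ∀ i, 0 ≤ r i) (hr1 : ∀ i, r i ≤ 1) :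
    ∑ i, D i * Real.arccos (r i) + (1 - ∑ i, D i) * (Real.pi / 2) ≤
      Real.arccos (∑ i, D i * r i) := by
  have hsub : Set.Icc 0 (Real.pi / 2) ⊆ Set.Icc (-(Real.pi / 2)) (Real.pi / 2) :=
    Set.Icc_subset_Icc_left (by linarith [Real.pi_pos])
  have hmem : ∀ i, Real.arccos (r i) ∈ Set.Icc 0 (Real.pi / 2) := fun i =>
    arccos_mem_Icc_zero_pi_div_two (hr i)
  have h := strictConcaveOn_cos_Icc.concaveOn.le_map_sum (t := Finset.univ)
    (w := fun o : Option ι => o.elim (1 - ∑ i, D i) D)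
    (p := fun o : Option ι => o.elim (Real.pi / 2) fun i => Real.arccos (r i))
    (by rintro (_ | i) - <;> simp [hD, hD1]) (by simp [Fintype.sum_option])
    (by
      rintro (_ | i) -
      · exact hsub (Set.right_mem_Icc.2 Real.pi_div_two_pos.le)
      · exact hsub (hmem i))
  simp only [Fintype.sum_option, Option.elim, smul_eq_mul, Real.cos_pi_div_two, mul_zero,
    zero_add] at h
  have e : ∀ i, Real.cos (Real.arccos (r i)) = r i := fun i =>
    Real.cos_arccos (by linarith [hr i]) (hr1 i)
  simp only [e] at h
  have h0 : 0 ≤ ∑ i, D i * Real.arccos (r i) + (1 - ∑ i, D i) * (Real.pi / 2) :=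
    add_nonneg (Finset.sum_nonneg fun i _ => mul_nonneg (hD i) (hmem i).1)
      (mul_nonneg (by linarith) (by positivity))
  have h1 : ∑ i, D i * Real.arccos (r i) + (1 - ∑ i, D i) * (Real.pi / 2) ≤ Real.pi := by
    have : ∑ i, D i * Real.arccos (r i) ≤ ∑ i, D i * (Real.pi / 2) :=
      Finset.sum_le_sum fun i _ => mul_le_mul_of_nonneg_left (hmem i).2 (hD i)
    rw [← Finset.sum_mul] at this
    linarith [Real.pi_pos]
  rw [← Real.arccos_cos h0 h1]
  exact Real.arccos_le_arccos (by rwa [add_comm (∑ i, D i * Real.arccos (r i))])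

/-! ### Principal systems of two subspaces -/

section

variable {E : Type*} [NormedAddCommGroup E] [InnerProductSpace ℝ E]

/-- Bessel's inequality for an orthogonal family of vectors of norm at most one, some of which
may vanish. -/
theorem sum_inner_sq_le_of_orthogonal {ι : Type*} [Fintype ι] (g : ι → E)
    (hg : ∀ i j, i ≠ j → inner ℝ (g i) (g j) = 0) (hg1 : ∀ i, inner ℝ (g i) (g i) ≤ 1) (u : E) :
    ∑ i, inner ℝ u (g i) ^ 2 ≤ inner ℝ u u := by
  set v := ∑ i, inner ℝ u (g i) • g i
  have hvg : ∀ i, inner ℝ v (g i) = inner ℝ u (g i) * inner ℝ (g i) (g i) := fun i => by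
    rw [sum_inner, Finset.sum_eq_single i (fun j _ hj => by
      rw [real_inner_smul_left, hg j i hj, mul_zero]) (by simp), real_inner_smul_left]
  have huv : inner ℝ u v = ∑ i, inner ℝ u (g i) ^ 2 := by
    rw [inner_sum]
    exact Finset.sum_congr rfl fun i _ => by rw [real_inner_smul_right, sq]
  have hvv : inner ℝ v v ≤ ∑ i, inner ℝ u (g i) ^ 2 := by
    conv_lhs => rw [show inner ℝ v v = inner ℝ v (∑ i, inner ℝ u (g i) • g i) from rfl, inner_sum]
    refine Finset.sum_le_sum fun i _ => ?_
    rw [real_inner_smul_right, hvg]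
    nlinarith [hg1 i, sq_nonneg (inner ℝ u (g i))]
  have h0 : 0 ≤ inner ℝ (u - v) (u - v) := real_inner_self_nonneg
  rw [real_inner_sub_sub_self] at h0
  linarith

theorem Orthonormal.sum_inner_sq_le {ι : Type*} [Fintype ι] {g : ι → E} (hg : Orthonormal ℝ g)
    (u : E) : ∑ i, inner ℝ u (g i) ^ 2 ≤ inner ℝ u u :=
  sum_inner_sq_le_of_orthogonal g (fun _ _ h => hg.2 h)
    (fun i => by rw [real_inner_self_eq_norm_sq, hg.1 i, one_pow]) u

theorem Orthonormal.inner_self_eq_one {ι : Type*} {g : ι → E} (hg : Orthonormal ℝ g) (i : ι) :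
    inner ℝ (g i) (g i) = 1 := by
  rw [real_inner_self_eq_norm_sq, hg.1 i, one_pow]

theorem Orthonormal.exists_sum_of_mem_span {ι : Type*} [Fintype ι] {g : ι → E}
    (hg : Orthonormal ℝ g) {v : E} (hv : v ∈ Submodule.span ℝ (Set.range g)) :
    v = ∑ i, inner ℝ (g i) v • g i := by
  obtain ⟨c, rfl⟩ := (Submodule.mem_span_range_iff_exists_fun ℝ).1 hv
  simp [hg.inner_right_fintype]

/-- The singular value decomposition of a linear map into a space of at least the same
dimension. -/
theorem LinearMap.exists_orthonormal_apply_eq_singularValues_smul {F G : Type*}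
    [NormedAddCommGroup F] [InnerProductSpace ℝ F] [FiniteDimensional ℝ F]
    [NormedAddCommGroup G] [InnerProductSpace ℝ G] [FiniteDimensional ℝ G]
    (T : F →ₗ[ℝ] G) {k : ℕ} (hk : Module.finrank ℝ F = k) (hkG : k ≤ Module.finrank ℝ G) :
    ∃ (v : OrthonormalBasis (Fin k) ℝ F) (u : Fin k → G), Orthonormal ℝ u ∧
      ∀ j : Fin k, T (v j) = T.singularValues j • u j := by
  set v := T.isSymmetric_adjoint_comp_self.eigenvectorBasis hk
  have hT : ∀ i j, inner ℝ (T (v i)) (T (v j)) =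
      T.singularValues i ^ 2 * inner ℝ (v i) (v j) := fun i j => by
    have := T.isSymmetric_adjoint_comp_self.apply_eigenvectorBasis hk i
    rw [← LinearMap.adjoint_inner_left, ← LinearMap.comp_apply, this, ← T.sq_singularValues_fin hk]
    simp [real_inner_smul_left, v]
  set w : Fin (Module.finrank ℝ G) → G := fun i =>
    if h : (i : ℕ) < k then (T.singularValues i)⁻¹ • T (v ⟨i, h⟩) else 0
  have hw : Orthonormal ℝ (({i | (i : ℕ) < k ∧ T.singularValues i ≠ 0} :
      Set (Fin (Module.finrank ℝ G))).domRestrict w) := by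
    rw [orthonormal_iff_ite]
    rintro ⟨i, hi, hi0⟩ ⟨j, hj, hj0⟩
    have hij : ((⟨i, hi⟩ : Fin k) = ⟨j, hj⟩) ↔ i = j := by simp [Fin.ext_iff]
    simp only [Set.domRestrict_apply, w, hi, hj, dif_pos, real_inner_smul_left,
      real_inner_smul_right, hT, orthonormal_iff_ite.1 v.orthonormal, hij, Subtype.mk.injEq]
    split_ifs with h
    · subst h
      field_simp
    · simp
  obtain ⟨b, hb⟩ := hw.exists_orthonormalBasis_extension_of_card_eq (by simp)
  refine ⟨v, fun j => b (Fin.castLE hkG j),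
    b.orthonormal.comp _ (Fin.castLE_injective hkG), fun j => ?_⟩
  by_cases h0 : T.singularValues j = 0
  -- Here `u_j` is an arbitrary vector of the extension, and `T v_j` has norm zero.
  · have := hT j j
    rw [h0] at this
    simpa [h0] using this
  · have := hb (Fin.castLE hkG j) ⟨j.2, h0⟩
    simp [this, w, h0]

/-- A principal system of the subspaces `U`, `V`: an orthonormal basis `x` of `U` and orthonormal
vectors `y_j` of `V` such that the orthogonal projection of `x_j` to `V` is `τ_j y_j`, where
`τ` is decreasing and nonnegative. The `τ_j` are the cosines of the principal angles; the
dimension of `U` may be smaller than that of `V`. -/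
structure IsPrincipalSystem {k : ℕ} (U V : Submodule ℝ E) (x y : Fin k → E) (τ : Fin k → ℝ) :
    Prop where
  orthonormal_left : Orthonormal ℝ x
  span_left : Submodule.span ℝ (Set.range x) = U
  orthonormal_right : Orthonormal ℝ y
  mem_right : ∀ j, y j ∈ V
  nonneg : ∀ j, 0 ≤ τ j
  antitone : Antitone τ
  inner_eq : ∀ j, ∀ v ∈ V, inner ℝ (x j) v = τ j * inner ℝ (y j) v

theorem exists_isPrincipalSystem [FiniteDimensional ℝ E] {k : ℕ} (U V : Submodule ℝ E)
    (hU : Module.finrank ℝ U = k) (hV : k ≤ Module.finrank ℝ V) :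
    ∃ (x y : Fin k → E) (τ : Fin k → ℝ), IsPrincipalSystem U V x y τ := by
  set T : U →ₗ[ℝ] V := (V.orthogonalProjectionOnto : E →ₗ[ℝ] V) ∘ₗ U.subtype
  obtain ⟨x, y, hy, h⟩ := T.exists_orthonormal_apply_eq_singularValues_smul hU hV
  refine ⟨fun j => x j, fun j => y j, fun j => T.singularValues j,
    x.orthonormal.comp_linearIsometry U.subtypeₗᵢ, ?_,
    hy.comp_linearIsometry V.subtypeₗᵢ, fun j => (y j).2, fun j => T.singularValues_nonneg _,
    fun i j hij => T.singularValues_antitone hij, fun j v hv => ?_⟩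
  · have := congrArg (Submodule.map U.subtype) x.toBasis.span_eq
    rw [Submodule.map_span, ← Set.range_comp, Submodule.map_subtype_top] at this
    simpa [Function.comp_def] using this
  · have h1 := congrArg (fun z => inner ℝ z (⟨v, hv⟩ : V)) (h j)
    simp only [real_inner_smul_left] at h1
    have h2 : inner ℝ (T (x j)) (⟨v, hv⟩ : V) = inner ℝ (x j : E) v :=
      Submodule.inner_orthogonalProjectionOnto_eq_of_mem_right ⟨v, hv⟩ (x j : E)
    rw [h2] at h1
    exact h1

namespace IsPrincipalSystem

variable {k : ℕ} {U V : Submodule ℝ E} {x y : Fin k → E} {τ : Fin k → ℝ}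

theorem mem_left (h : IsPrincipalSystem U V x y τ) (j : Fin k) : x j ∈ U :=
  h.span_left ▸ Submodule.subset_span ⟨j, rfl⟩

theorem inner_left_right (h : IsPrincipalSystem U V x y τ) (i j : Fin k) :
    inner ℝ (x i) (y j) = if i = j then τ i else 0 := by
  rw [h.inner_eq i _ (h.mem_right j), orthonormal_iff_ite.1 h.orthonormal_right]
  split_ifs <;> simp

theorem le_one (h : IsPrincipalSystem U V x y τ) (j : Fin k) : τ j ≤ 1 := by
  have := real_inner_le_norm (x j) (y j)
  rw [h.inner_left_right, h.orthonormal_left.1, h.orthonormal_right.1] at this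
  simpa using this

theorem finrank_left (h : IsPrincipalSystem U V x y τ) : Module.finrank ℝ U = k := by
  rw [← h.span_left, finrank_span_eq_card h.orthonormal_left.linearIndependent, Fintype.card_fin]

/-- When `U` and `V` have the same dimension, the two sides of a principal system can be
exchanged. -/
theorem symm [FiniteDimensional ℝ E] (h : IsPrincipalSystem U V x y τ)
    (hV : Module.finrank ℝ V = k) : IsPrincipalSystem V U y x τ where
  orthonormal_left := h.orthonormal_right
  span_left := by
    refine Submodule.eq_of_le_of_finrank_eq (Submodule.span_le.2 ?_) ?_
    · rintro _ ⟨j, rfl⟩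
      exact h.mem_right j
    · rw [finrank_span_eq_card h.orthonormal_right.linearIndependent, hV, Fintype.card_fin]
  orthonormal_right := h.orthonormal_left
  mem_right := h.mem_left
  nonneg := h.nonneg
  antitone := h.antitone
  inner_eq j v hv := by
    rw [← h.span_left] at hv
    obtain ⟨c, rfl⟩ := (Submodule.mem_span_range_iff_exists_fun ℝ).1 hv
    have hyx : ∀ i, inner ℝ (y j) (x i) = if i = j then τ i else 0 := fun i => by
      rw [real_inner_comm, h.inner_left_right]
    simp only [inner_sum, real_inner_smul_right, orthonormal_iff_ite.1 h.orthonormal_left, hyx]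
    simp [mul_comm]

/-- Cauchy interlacing: the cosines of a subspace of codimension `m` dominate those of the large
space after an index shift by `m`. The span of the `x_i` with `i ≥ j` meets the span of the
first `m + j + 1` vectors of the large system in a nonzero vector. -/
theorem le_of_le [FiniteDimensional ℝ E] {m : ℕ} {L : Submodule ℝ E} {e f : Fin (m + k) → E}
    {σ : Fin (m + k) → ℝ} (h : IsPrincipalSystem U V x y τ) (h' : IsPrincipalSystem L V e f σ)
    (hUL : U ≤ L) (j : Fin k) : σ (Fin.natAdd m j) ≤ τ j := by
  set x₁ : {i // j ≤ i} → E := fun i => x i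
  set e₁ : {i // i ≤ Fin.natAdd m j} → E := fun i => e i
  have hx₁ : Orthonormal ℝ x₁ := h.orthonormal_left.comp _ Subtype.val_injective
  have he₁ : Orthonormal ℝ e₁ := h'.orthonormal_left.comp _ Subtype.val_injective
  obtain ⟨v, hvA, hvB, hv0⟩ : ∃ v ∈ Submodule.span ℝ (Set.range x₁),
      v ∈ Submodule.span ℝ (Set.range e₁) ∧ v ≠ 0 := by
    have hA : Submodule.span ℝ (Set.range x₁) ≤ L := by
      refine (Submodule.span_le.2 ?_).trans hUL
      rintro _ ⟨i, rfl⟩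
      exact h.mem_left i
    have hB : Submodule.span ℝ (Set.range e₁) ≤ L := by
      refine Submodule.span_le.2 ?_
      rintro _ ⟨i, rfl⟩
      exact h'.mem_left i
    have hs := Submodule.finrank_mono (sup_le hA hB)
    have hd := Submodule.finrank_sup_add_finrank_inf_eq (Submodule.span ℝ (Set.range x₁))
      (Submodule.span ℝ (Set.range e₁))
    have c₁ : Fintype.card {i // j ≤ i} = k - j := by
      rw [Fintype.card_subtype]
      simp [← Fin.card_Ici]
      congr 1; ext; simp
    have c₂ : Fintype.card {i // i ≤ Fin.natAdd m j} = m + j + 1 := by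
      rw [Fintype.card_subtype]
      have := Fin.card_Iic (Fin.natAdd m j)
      rw [Fin.val_natAdd] at this
      rw [← this]
      congr 1; ext; simp
    rw [finrank_span_eq_card hx₁.linearIndependent, finrank_span_eq_card he₁.linearIndependent,
      c₁, c₂] at hd
    rw [h'.finrank_left] at hs
    have hj := j.2
    have hpos : 0 < Module.finrank ℝ ↥(Submodule.span ℝ (Set.range x₁) ⊓
        Submodule.span ℝ (Set.range e₁)) := by omega
    obtain ⟨v, hv, hv0⟩ := Submodule.exists_mem_ne_zero_of_ne_bot
      (fun hbot => by rw [hbot, finrank_bot] at hpos; exact lt_irrefl _ hpos :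
        Submodule.span ℝ (Set.range x₁) ⊓ Submodule.span ℝ (Set.range e₁) ≠ ⊥)
    exact ⟨v, hv.1, hv.2, hv0⟩
  obtain ⟨a, hvx⟩ : ∃ a : {i // j ≤ i} → ℝ, v = ∑ i, a i • x₁ i :=
    ⟨_, hx₁.exists_sum_of_mem_span hvA⟩
  obtain ⟨b, hve⟩ : ∃ b : {i // i ≤ Fin.natAdd m j} → ℝ, v = ∑ i, b i • e₁ i :=
    ⟨_, he₁.exists_sum_of_mem_span hvB⟩
  set z : E := ∑ i, b i • f i.1
  have hf₁ : Orthonormal ℝ fun i : {i // i ≤ Fin.natAdd m j} => f i.1 :=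
    h'.orthonormal_right.comp _ Subtype.val_injective
  have hy₁ : Orthonormal ℝ fun i : {i // j ≤ i} => y i.1 :=
    h.orthonormal_right.comp _ Subtype.val_injective
  have hz : z ∈ V := Submodule.sum_mem _ fun i _ => Submodule.smul_mem _ _ (h'.mem_right _)
  have hvv : inner ℝ v v = ∑ i, b i ^ 2 := by
    conv_lhs => rw [hve, he₁.inner_sum]
    simp [sq]
  have hvv' : inner ℝ v v = ∑ i, a i ^ 2 := by
    conv_lhs => rw [hvx, hx₁.inner_sum]
    simp [sq]
  have hzz : inner ℝ z z = inner ℝ v v := by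
    rw [hvv, hf₁.inner_sum]
    simp [sq]
  have low : σ (Fin.natAdd m j) * inner ℝ v v ≤ inner ℝ v z := by
    have e1 : inner ℝ v z = ∑ i, σ i.1 * b i ^ 2 := by
      conv_lhs => rw [hve, sum_inner]
      refine Finset.sum_congr rfl fun i _ => ?_
      rw [real_inner_smul_left, h'.inner_eq _ _ hz, hf₁.inner_right_fintype b i]
      ring
    rw [e1, hvv, Finset.mul_sum]
    exact Finset.sum_le_sum fun i _ =>
      mul_le_mul_of_nonneg_right (h'.antitone i.2) (sq_nonneg _)
  -- On the span of the `x_i`, `i ≥ j`, the projection to `V` has norm at most `τ_j`.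
  have up : inner ℝ v z ≤ τ j * inner ℝ v v := by
    have e1 : inner ℝ v z = ∑ i, τ i.1 * (a i * inner ℝ z (y i.1)) := by
      conv_lhs => rw [hvx, sum_inner]
      refine Finset.sum_congr rfl fun i _ => ?_
      rw [real_inner_smul_left, h.inner_eq _ _ hz, real_inner_comm z]
      ring
    have e2 : ∀ i : {i // j ≤ i}, τ i.1 * (a i * inner ℝ z (y i.1)) ≤
        τ j * ((a i ^ 2 + inner ℝ z (y i.1) ^ 2) / 2) := fun i =>
      (mul_le_mul_of_nonneg_left (by nlinarith [sq_nonneg (a i - inner ℝ z (y i.1))])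
        (h.nonneg _)).trans (mul_le_mul_of_nonneg_right (h.antitone i.2) (by positivity))
    rw [e1]
    refine (Finset.sum_le_sum fun i _ => e2 i).trans ?_
    rw [← Finset.mul_sum, ← Finset.sum_div, Finset.sum_add_distrib, ← hvv']
    refine mul_le_mul_of_nonneg_left ?_ (h.nonneg j)
    have := hy₁.sum_inner_sq_le z
    rw [hzz] at this
    linarith
  exact le_of_mul_le_mul_right (low.trans up) (real_inner_self_pos.2 hv0)

theorem le_of_eq_left [FiniteDimensional ℝ E] {e f : Fin k → E} {σ : Fin k → ℝ}
    (h : IsPrincipalSystem U V x y τ) (h' : IsPrincipalSystem U V e f σ) (j : Fin k) :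
    σ j ≤ τ j := by
  have hc : ∀ (n : ℕ) (hn : k = n) (e f : Fin k → E) (σ : Fin k → ℝ),
      IsPrincipalSystem U V e f σ → IsPrincipalSystem U V (fun i : Fin n => e (Fin.cast hn.symm i))
        (fun i => f (Fin.cast hn.symm i)) (fun i => σ (Fin.cast hn.symm i)) := by
    rintro n rfl e f σ h
    exact h
  have := h.le_of_le (m := 0) (hc (0 + k) (zero_add k).symm e f σ h') le_rfl j
  convert this using 2
  ext; simp

/-- The cosines of the principal angles do not depend on the principal system. -/
theorem unique [FiniteDimensional ℝ E] {e f : Fin k → E} {σ : Fin k → ℝ}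
    (h : IsPrincipalSystem U V x y τ) (h' : IsPrincipalSystem U V e f σ) : τ = σ :=
  funext fun j => le_antisymm (h'.le_of_eq_left h j) (h.le_of_eq_left h' j)

/-- Principal systems minimize the sum of the angles between paired vectors: the moduli of the inner
products of any other pairs are averages of the `τ_i` with doubly substochastic weights. -/
theorem sum_arccos_le (h : IsPrincipalSystem U V x y τ) {ρ : ℝ} (hρ0 : 0 ≤ ρ) (hρ1 : ρ ≤ 1)
    {x' y' : Fin k → E} (hx' : Orthonormal ℝ x') (hx'U : ∀ j, x' j ∈ U) (hy' : Orthonormal ℝ y')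
    (hy'V : ∀ j, y' j ∈ V) :
    ∑ j, Real.arccos (ρ * τ j) ≤ ∑ j, Real.arccos (ρ * |inner ℝ (x' j) (y' j)|) := by
  set D : Fin k → Fin k → ℝ := fun i j =>
    (inner ℝ (x' j) (x i) ^ 2 + inner ℝ (y' j) (y i) ^ 2) / 2
  have hD0 : ∀ i j, 0 ≤ D i j := fun i j => by positivity
  have hDr : ∀ j, ∑ i, D i j ≤ 1 := fun j => by
    have h1 := h.orthonormal_left.sum_inner_sq_le (x' j)
    have h2 := h.orthonormal_right.sum_inner_sq_le (y' j)
    rw [hx'.inner_self_eq_one] at h1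
    rw [hy'.inner_self_eq_one] at h2
    rw [← Finset.sum_div, Finset.sum_add_distrib]
    linarith
  have hDc : ∀ i, ∑ j, D i j ≤ 1 := fun i => by
    have h1 := hx'.sum_inner_sq_le (x i)
    have h2 := hy'.sum_inner_sq_le (y i)
    rw [h.orthonormal_left.inner_self_eq_one] at h1
    rw [h.orthonormal_right.inner_self_eq_one] at h2
    simp only [D, real_inner_comm (x i), real_inner_comm (y i)]
    rw [← Finset.sum_div, Finset.sum_add_distrib]
    linarith
  have hle : ∀ j, |inner ℝ (x' j) (y' j)| ≤ ∑ i, D i j * τ i := fun j => by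
    have e : inner ℝ (x' j) (y' j) =
        ∑ i, inner ℝ (x' j) (x i) * inner ℝ (y' j) (y i) * τ i := by
      have := h.orthonormal_left.exists_sum_of_mem_span (by rw [h.span_left]; exact hx'U j)
      conv_lhs => rw [this, sum_inner]
      refine Finset.sum_congr rfl fun i _ => ?_
      rw [real_inner_smul_left, h.inner_eq _ _ (hy'V j), real_inner_comm (x' j),
        real_inner_comm (y' j)]
      ring
    rw [e]
    refine (Finset.abs_sum_le_sum_abs _ _).trans (Finset.sum_le_sum fun i _ => ?_)
    rw [abs_mul, abs_of_nonneg (h.nonneg i)]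
    refine mul_le_mul_of_nonneg_right ?_ (h.nonneg i)
    rw [abs_mul]
    have := sq_nonneg (|inner ℝ (x' j) (x i)| - |inner ℝ (y' j) (y i)|)
    rw [sub_sq, sq_abs, sq_abs] at this
    simp only [D]
    linarith
  have hr0 : ∀ i, 0 ≤ ρ * τ i := fun i => mul_nonneg hρ0 (h.nonneg i)
  have hr1 : ∀ i, ρ * τ i ≤ 1 := fun i => mul_le_one₀ hρ1 (h.nonneg i) (h.le_one i)
  have hmain : ∀ j, ∑ i, D i j * Real.arccos (ρ * τ i) + (1 - ∑ i, D i j) * (Real.pi / 2) ≤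
      Real.arccos (ρ * |inner ℝ (x' j) (y' j)|) := fun j => by
    refine (sum_mul_arccos_le_arccos_sum (fun i => D i j) (fun i => ρ * τ i) (fun i => hD0 i j)
      (hDr j) hr0 hr1).trans (Real.arccos_le_arccos ?_)
    refine (mul_le_mul_of_nonneg_left (hle j) hρ0).trans (le_of_eq ?_)
    rw [Finset.mul_sum]
    exact Finset.sum_congr rfl fun i _ => by ring
  refine le_trans ?_ (Finset.sum_le_sum fun j _ => hmain j)
  have hrest : ∑ i, (1 - ∑ j, D i j) * Real.arccos (ρ * τ i) ≤
      ∑ i, (1 - ∑ j, D i j) * (Real.pi / 2) :=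
    Finset.sum_le_sum fun i _ => mul_le_mul_of_nonneg_left
      (Real.arccos_le_pi_div_two.2 (hr0 i)) (by linarith [hDc i])
  simp only [sub_mul, Finset.sum_sub_distrib, Finset.sum_add_distrib, one_mul,
    Finset.sum_mul] at hrest ⊢
  rw [Finset.sum_comm] at hrest
  rw [Finset.sum_comm (f := fun i j => D i j * (Real.pi / 2))] at hrest
  linarith

end IsPrincipalSystem

end

/-! ### Variation of the principal angles along a geodesic -/

section

variable {E : Type*} [NormedAddCommGroup E] [InnerProductSpace ℝ E]

namespace IsPrincipalSystem

variable {k : ℕ} {U V : Submodule ℝ E} {x y : Fin k → E} {τ : Fin k → ℝ}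

/-- The normalized components of the `x_j` orthogonal to `V`, with denominators regularized by
`ρ`, are orthogonal of norm at most one. -/
theorem inner_residual (h : IsPrincipalSystem U V x y τ) {ρ : ℝ} (hρ0 : 0 ≤ ρ) (hρ1 : ρ < 1)
    (i j : Fin k) :
    inner ℝ ((ρ / √(1 - (ρ * τ i) ^ 2)) • (x i - τ i • y i))
        ((ρ / √(1 - (ρ * τ j) ^ 2)) • (x j - τ j • y j)) =
      if i = j then ρ ^ 2 * (1 - τ i ^ 2) / (1 - (ρ * τ i) ^ 2) else 0 := by
  have hyx : inner ℝ (y i) (x j) = if i = j then τ i else 0 := by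
    rw [real_inner_comm, h.inner_left_right]
    split_ifs with h1 h2 h2 <;> simp_all
  simp only [real_inner_smul_left, real_inner_smul_right, inner_sub_left, inner_sub_right,
    orthonormal_iff_ite.1 h.orthonormal_left, orthonormal_iff_ite.1 h.orthonormal_right,
    h.inner_left_right, hyx]
  split_ifs with hij
  · subst hij
    have : 0 < 1 - (ρ * τ i) ^ 2 := by
      nlinarith [h.nonneg i, h.le_one i, mul_nonneg hρ0 (h.nonneg i),
        mul_le_mul_of_nonneg_left (h.le_one i) hρ0]
    have hS := Real.sq_sqrt this.le
    have hs := (Real.sqrt_pos.2 this).ne'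
    generalize √(1 - (ρ * τ i) ^ 2) = S at hS hs ⊢
    rw [← hS]
    field_simp
    ring
  · simp

/-- Moving `V` for a time `t` along the geodesic with initial frame `f`, directions `g` and
principal speeds `θ` increases the sum of the `k` principal angles by at most `t` times
the sum of the `k` largest speeds, up to second order in `t`. The factor `ρ < 1` keeps the arguments
of `arccos` away from its singularity at `1`, so that the error is uniform in `U` and `V`. -/
theorem sum_arccos_le_add {m : ℕ} {f g f' : Fin (m + k) → E} (hf : Orthonormal ℝ f)
    (hfg : ∀ i j, inner ℝ (f i) (g j) = 0) (hg : ∀ i j, i ≠ j → inner ℝ (g i) (g j) = 0)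
    (hg1 : ∀ i, inner ℝ (g i) (g i) ≤ 1) (hf' : Orthonormal ℝ f') {θ : Fin (m + k) → ℝ}
    (hθ : Monotone θ) (hθ0 : ∀ i, 0 ≤ θ i) {t : ℝ} (ht : 0 ≤ t)
    (hff' : ∀ i, f' i = Real.cos (t * θ i) • f i + Real.sin (t * θ i) • g i)
    {x' y' : Fin k → E} {τ' : Fin k → ℝ}
    (h : IsPrincipalSystem U (Submodule.span ℝ (Set.range f)) x y τ)
    (h' : IsPrincipalSystem U (Submodule.span ℝ (Set.range f')) x' y' τ')
    {ρ : ℝ} (hρ0 : 0 ≤ ρ) (hρ1 : ρ < 1) :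
    ∑ j, Real.arccos (ρ * τ' j) ≤ ∑ j, Real.arccos (ρ * τ j) +
      t * ∑ j, θ (Fin.natAdd m j) + t ^ 2 * (k * ∑ i, θ i ^ 2 / (2 * √(1 - ρ ^ 2))) := by
  set c : Fin k → Fin (m + k) → ℝ := fun j i => inner ℝ (f i) (y j)
  have hy : ∀ j, y j = ∑ i, c j i • f i := fun j => hf.exists_sum_of_mem_span (h.mem_right j)
  -- `Y_j` is `y_j` transported by the isometry that sends the frame `f` to `f'`.
  set Y : Fin k → E := fun j => ∑ i, c j i • f' i
  have hY : Orthonormal ℝ Y := by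
    rw [orthonormal_iff_ite]
    intro i j
    rw [← orthonormal_iff_ite.1 h.orthonormal_right i j, hf'.inner_sum]
    conv_rhs => rw [hy i, hy j, hf.inner_sum]
  have hYV : ∀ j, Y j ∈ Submodule.span ℝ (Set.range f') := fun j =>
    Submodule.sum_mem _ fun i _ => Submodule.smul_mem _ _ (Submodule.subset_span ⟨i, rfl⟩)
  set s : Fin k → ℝ := fun j => √(1 - (ρ * τ j) ^ 2)
  set r := √(1 - ρ ^ 2)
  have hr : 0 < r := Real.sqrt_pos.2 (by nlinarith)
  have hρτ0 : ∀ j, 0 ≤ ρ * τ j := fun j => mul_nonneg hρ0 (h.nonneg j)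
  have hρτ : ∀ j, ρ * τ j ≤ ρ := fun j => mul_le_of_le_one_right hρ0 (h.le_one j)
  have hrs : ∀ j, r ≤ s j := fun j => Real.sqrt_le_sqrt (by
    have := hρτ j
    have := hρτ0 j
    gcongr)
  have hs : ∀ j, 0 < s j := fun j => hr.trans_le (hrs j)
  set ω : Fin k → E := fun j => (ρ / s j) • (x j - τ j • y j)
  set d : Fin k → Fin (m + k) → ℝ := fun j i => (c j i ^ 2 + inner ℝ (ω j) (g i) ^ 2) / 2
  have hd0 : ∀ j i, 0 ≤ d j i := fun j i => by positivity
  have hω1 : ∀ j, inner ℝ (ω j) (ω j) ≤ 1 := fun j => by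
    have := h.inner_residual hρ0 hρ1 j j
    rw [if_pos rfl] at this
    refine this.trans_le ?_
    have h1 := hρτ j
    have h2 := hρτ0 j
    rw [div_le_one (by nlinarith)]
    nlinarith
  have hd1 : ∀ i, ∑ j, d j i ≤ 1 := fun i => by
    have h1 := h.orthonormal_right.sum_inner_sq_le (f i)
    have h2 := sum_inner_sq_le_of_orthogonal ω (fun i j hij => by
      have := h.inner_residual hρ0 hρ1 i j
      rwa [if_neg hij] at this) hω1 (g i)
    rw [hf.inner_self_eq_one] at h1
    rw [← Finset.sum_div, Finset.sum_add_distrib]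
    simp only [real_inner_comm (g i)]
    linarith [hg1 i]
  have hdk : ∑ i, ∑ j, d j i ≤ k := by
    rw [Finset.sum_comm]
    have : ∀ j, ∑ i, d j i ≤ 1 := fun j => by
      have h1 := hf.sum_inner_sq_le (y j)
      have h2 := sum_inner_sq_le_of_orthogonal g hg hg1 (ω j)
      rw [h.orthonormal_right.inner_self_eq_one] at h1
      simp only [real_inner_comm _ (y j)] at h1
      rw [← Finset.sum_div, Finset.sum_add_distrib]
      linarith [hω1 j]
    simpa using Finset.sum_le_sum fun j (_ : j ∈ Finset.univ) => this j
  have hyg : ∀ j i, inner ℝ (y j) (g i) = 0 := fun j i => by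
    rw [hy, sum_inner]
    exact Finset.sum_eq_zero fun l _ => by rw [real_inner_smul_left, hfg, mul_zero]
  have hωg : ∀ j i, inner ℝ (ω j) (g i) = ρ / s j * inner ℝ (x j) (g i) := fun j i => by
    simp [ω, real_inner_smul_left, inner_sub_left, hyg]
  have hdiff : ∀ j, inner ℝ (x j) (Y j) - τ j = ∑ i, c j i *
      ((Real.cos (t * θ i) - 1) * inner ℝ (x j) (f i) +
        Real.sin (t * θ i) * inner ℝ (x j) (g i)) := fun j => by
    have e1 : τ j = ∑ i, c j i * inner ℝ (x j) (f i) := by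
      have := h.inner_left_right j j
      rw [if_pos rfl] at this
      rw [← this]
      conv_lhs => rw [hy j, inner_sum]
      exact Finset.sum_congr rfl fun i _ => real_inner_smul_right _ _ _
    rw [e1, inner_sum, ← Finset.sum_sub_distrib]
    refine Finset.sum_congr rfl fun i _ => ?_
    rw [hff', real_inner_smul_right, inner_add_right, real_inner_smul_right, real_inner_smul_right]
    ring
  have habs : ∀ u v : E, inner ℝ u u = 1 → inner ℝ v v = 1 → |inner ℝ u v| ≤ 1 := by
    intro u v hu hv
    have := abs_real_inner_le_norm u v
    rw [real_inner_self_eq_norm_sq] at hu hv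
    rw [(pow_eq_one_iff_of_nonneg (norm_nonneg u) two_ne_zero).1 hu,
      (pow_eq_one_iff_of_nonneg (norm_nonneg v) two_ne_zero).1 hv] at this
    simpa using this
  have hterm : ∀ j, Real.arccos (ρ * |inner ℝ (x j) (Y j)|) ≤ Real.arccos (ρ * τ j) +
      ∑ i, (t * θ i * d j i + t ^ 2 * (θ i ^ 2 / (2 * r))) := fun j => by
    have hα1 := habs (x j) (Y j) (h.orthonormal_left.inner_self_eq_one j) (hY.inner_self_eq_one j)
    have h1 := arccos_le_sub_div_sqrt (mul_nonneg hρ0 (abs_nonneg (inner ℝ (x j) (Y j))))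
      (mul_le_one₀ hρ1.le (abs_nonneg _) hα1) (hρτ0 j) ((hρτ j).trans_lt hρ1)
    have h2 : ρ / s j * (inner ℝ (x j) (Y j) - τ j) ≤
        (ρ * |inner ℝ (x j) (Y j)| - ρ * τ j) / s j := by
      rw [div_mul_eq_mul_div, mul_sub]
      have := le_abs_self (inner ℝ (x j) (Y j))
      have := hs j
      gcongr
    have h3 : -(ρ / s j * (inner ℝ (x j) (Y j) - τ j)) ≤
        ∑ i, (t * θ i * d j i + t ^ 2 * (θ i ^ 2 / (2 * r))) := by
      rw [hdiff, Finset.mul_sum, ← Finset.sum_neg_distrib]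
      refine Finset.sum_le_sum fun i _ => ?_
      have hcos : 0 ≤ 1 - Real.cos (t * θ i) := sub_nonneg.2 (Real.cos_le_one _)
      have hcos' : 1 - Real.cos (t * θ i) ≤ (t * θ i) ^ 2 / 2 := by
        linarith [Real.one_sub_sq_div_two_le_cos (x := t * θ i)]
      have hρs0 : 0 ≤ ρ / s j := div_nonneg hρ0 (hs j).le
      have hρs : ρ / s j ≤ 1 / r := by
        have := hrs j
        gcongr
      have htθ := mul_nonneg ht (hθ0 i)
      have hsin : |Real.sin (t * θ i)| ≤ t * θ i := by
        have := Real.abs_sin_le_abs (x := t * θ i)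
        rwa [abs_of_nonneg htθ] at this
      have hcx : |c j i * inner ℝ (x j) (f i)| ≤ 1 := by
        rw [abs_mul]
        exact mul_le_one₀ (habs _ _ (hf.inner_self_eq_one i)
          (h.orthonormal_right.inner_self_eq_one j)) (abs_nonneg _)
          (habs _ _ (h.orthonormal_left.inner_self_eq_one j) (hf.inner_self_eq_one i))
      have k1 : ρ / s j * (1 - Real.cos (t * θ i)) * (c j i * inner ℝ (x j) (f i)) ≤
          t ^ 2 * (θ i ^ 2 / (2 * r)) := by
        calc _ ≤ 1 / r * ((t * θ i) ^ 2 / 2) * 1 := by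
              refine (mul_le_mul_of_nonneg_left ((le_abs_self _).trans hcx)
                (mul_nonneg hρs0 hcos)).trans ?_
              gcongr
          _ = _ := by field_simp
      have k2 : -(Real.sin (t * θ i) * (c j i * inner ℝ (ω j) (g i))) ≤ t * θ i * d j i := by
        have : |c j i * inner ℝ (ω j) (g i)| ≤ d j i := by
          rw [abs_le]
          constructor <;> simp only [d] <;>
            nlinarith [sq_nonneg (c j i - inner ℝ (ω j) (g i)),
              sq_nonneg (c j i + inner ℝ (ω j) (g i))]
        refine (neg_le_abs _).trans ?_
        rw [abs_mul]
        exact mul_le_mul hsin this (abs_nonneg _) htθ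
      rw [hωg] at k2
      linarith
    linarith
  refine (h'.sum_arccos_le hρ0 hρ1.le h.orthonormal_left h.mem_left hY hYV).trans
    ((Finset.sum_le_sum fun j _ => hterm j).trans ?_)
  have hfin := sum_mul_le_sum_natAdd θ (fun i => ∑ j, d j i) hθ hθ0
    (fun i => Finset.sum_nonneg fun j _ => hd0 j i) hd1 hdk
  have e : ∑ j, ∑ i, (t * θ i * d j i + t ^ 2 * (θ i ^ 2 / (2 * r))) =
      t * ∑ i, θ i * ∑ j, d j i + t ^ 2 * (k * ∑ i, θ i ^ 2 / (2 * r)) := by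
    simp only [Finset.sum_add_distrib, ← Finset.mul_sum, Finset.sum_const, Finset.card_univ,
      Fintype.card_fin, nsmul_eq_mul]
    rw [Finset.sum_comm]
    simp only [Finset.mul_sum]
    congr 1
    · exact Finset.sum_congr rfl fun i _ => Finset.sum_congr rfl fun j _ => by ring
  rw [Finset.sum_add_distrib, e]
  linarith [mul_le_mul_of_nonneg_left hfin ht]

end IsPrincipalSystem

end

/-! ### The triangle inequality for sums of the largest principal angles -/

/-- A function whose increments over steps of length `h` are at most `h T + h² C` grows by at
most `T` over the unit interval. -/
theorem le_add_of_forall_step_le {S : ℝ → ℝ} {T C : ℝ}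
    (hS : ∀ t h, 0 ≤ h → S (t + h) ≤ S t + h * T + h ^ 2 * C) : S 1 ≤ S 0 + T := by
  have hN : ∀ N : ℕ, S 1 ≤ S 0 + T + 1 / ((N : ℝ) + 1) * C := fun N => by
    set h : ℝ := 1 / ((N : ℝ) + 1)
    have hh : 0 ≤ h := by positivity
    have hi : ∀ i : ℕ, S (i * h) ≤ S 0 + i * (h * T + h ^ 2 * C) := fun i => by
      induction i with
      | zero => simp
      | succ i ih =>
        have := hS (i * h) h hh
        push_cast
        rw [show ((i : ℝ) + 1) * h = i * h + h by ring]
        linarith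
    have := hi (N + 1)
    have e : ((N + 1 : ℕ) : ℝ) * h = 1 := by
      push_cast
      exact mul_one_div_cancel (by positivity)
    rw [mul_add, ← mul_assoc, sq, ← mul_assoc, ← mul_assoc, e] at this
    linarith
  have hlim : Filter.Tendsto (fun N : ℕ => S 0 + T + 1 / ((N : ℝ) + 1) * C) Filter.atTop
      (nhds (S 0 + T + 0 * C)) :=
    (tendsto_one_div_add_atTop_nhds_zero_nat.mul_const C).const_add _
  simpa using ge_of_tendsto' hlim hN

section

variable {E : Type*} [NormedAddCommGroup E] [InnerProductSpace ℝ E]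

namespace IsPrincipalSystem

/-- Two subspaces of the same dimension are joined by a geodesic of frames `F t` with
directions `G t`, the `i`-th vector rotating with constant speed equal to the `i`-th principal angle.
Directions of speed zero are set to `0`. -/
theorem exists_geodesic_frame {n : ℕ} {M N : Submodule ℝ E} {a b : Fin n → E} {μ : Fin n → ℝ}
    (h : IsPrincipalSystem M N a b μ) :
    ∃ F G : ℝ → Fin n → E, F 0 = a ∧ F 1 = b ∧ (∀ t, Orthonormal ℝ (F t)) ∧
      (∀ t i j, inner ℝ (F t i) (G t j) = 0) ∧
      (∀ t i j, i ≠ j → inner ℝ (G t i) (G t j) = 0) ∧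
      (∀ t i, inner ℝ (G t i) (G t i) ≤ 1) ∧
      ∀ t s i, F (t + s) i = Real.cos (s * Real.arccos (μ i)) • F t i +
        Real.sin (s * Real.arccos (μ i)) • G t i := by
  set θ : Fin n → ℝ := fun i => Real.arccos (μ i)
  have hcos : ∀ i, Real.cos (θ i) = μ i := fun i =>
    Real.cos_arccos (by linarith [h.nonneg i]) (h.le_one i)
  set g : Fin n → E := fun i => (Real.sin (θ i))⁻¹ • (b i - μ i • a i)
  set γ : Fin n → ℝ := fun i => if Real.sin (θ i) = 0 then 0 else 1
  have hba : ∀ i j, inner ℝ (b i) (a j) = if i = j then μ i else 0 := fun i j => by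
    rw [real_inner_comm, h.inner_left_right]
    split_ifs with h1 h2 h2 <;> simp_all
  have haa := orthonormal_iff_ite.1 h.orthonormal_left
  have hag : ∀ i j, inner ℝ (a i) (g j) = 0 := fun i j => by
    simp only [g, real_inner_smul_right, inner_sub_right, h.inner_left_right, haa]
    split_ifs with hij
    · simp [hij]
    · simp
  have hga : ∀ i j, inner ℝ (g i) (a j) = 0 := fun i j => by rw [real_inner_comm, hag]
  have hgg : ∀ i j, inner ℝ (g i) (g j) = if i = j then γ i else 0 := fun i j => by
    simp only [g, γ, real_inner_smul_left, real_inner_smul_right, inner_sub_left, inner_sub_right,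
      h.inner_left_right, haa, hba, orthonormal_iff_ite.1 h.orthonormal_right]
    split_ifs with hij hs
    · subst hij
      simp [hs]
    · subst hij
      rw [← hcos i]
      have := Real.sin_sq_add_cos_sq (θ i)
      field_simp
      linarith
    · simp
  have hθ : ∀ i, Real.sin (θ i) = 0 → θ i = 0 := fun i hi => by
    by_contra h0
    have h1 := arccos_mem_Icc_zero_pi_div_two (h.nonneg i)
    exact (Real.sin_pos_of_pos_of_lt_pi (lt_of_le_of_ne h1.1 (Ne.symm h0))
      (by linarith [h1.2, Real.pi_pos])).ne' hi
  have hγ : ∀ t i, Real.sin (t * θ i) * γ i = Real.sin (t * θ i) := fun t i => by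
    by_cases hs : Real.sin (θ i) = 0
    · simp [hθ i hs]
    · simp [γ, hs]
  refine ⟨fun t i => Real.cos (t * θ i) • a i + Real.sin (t * θ i) • g i,
    fun t i => -Real.sin (t * θ i) • a i + Real.cos (t * θ i) • g i, ?_, ?_, fun t => ?_,
    fun t i j => ?_, fun t i j hij => ?_, fun t i => ?_, fun t s i => ?_⟩
  · funext i; simp
  · funext i
    simp only [one_mul]
    by_cases hs : Real.sin (θ i) = 0
    · have h1 : μ i = 1 := by rw [← hcos, hθ i hs, Real.cos_zero]
      have h2 := h.inner_left_right i i
      rw [if_pos rfl, h1] at h2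
      rw [(inner_eq_one_iff_of_norm_eq_one (h.orthonormal_left.1 i)
        (h.orthonormal_right.1 i)).1 h2, hs, hcos, h1]
      simp
    · simp only [g, hcos, smul_smul, mul_inv_cancel₀ hs]
      simp
  · rw [orthonormal_iff_ite]
    intro i j
    simp only [inner_add_left, inner_add_right, real_inner_smul_left, real_inner_smul_right, haa,
      hag, hga, hgg]
    split_ifs with hij
    · subst hij
      linear_combination Real.sin_sq_add_cos_sq (t * θ i) + Real.sin (t * θ i) * hγ t i
    · simp
  · simp only [inner_add_left, inner_add_right, real_inner_smul_left, real_inner_smul_right, haa,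
      hag, hga, hgg]
    split_ifs with hij
    · subst hij
      linear_combination Real.cos (t * θ i) * hγ t i
    · simp
  · simp [inner_add_left, inner_add_right, real_inner_smul_left, real_inner_smul_right, haa,
      hag, hga, hgg, hij]
  · simp only [inner_add_left, inner_add_right, real_inner_smul_left, real_inner_smul_right, haa,
      hag, hga, hgg, if_true]
    have h1 : γ i ≤ 1 := by simp only [γ]; split_ifs <;> norm_num
    nlinarith [Real.sin_sq_add_cos_sq (t * θ i), sq_nonneg (Real.cos (t * θ i))]
  · simp only [add_mul, Real.cos_add, Real.sin_add, sub_smul, add_smul, smul_add, smul_smul,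
      neg_smul, smul_neg]
    module

/-- The restriction to the last `k` vectors, which carry the `k` largest angles. -/
theorem natAdd {m k : ℕ} {L N : Submodule ℝ E} {c d : Fin (m + k) → E} {ν : Fin (m + k) → ℝ}
    (h : IsPrincipalSystem L N c d ν) :
    IsPrincipalSystem (Submodule.span ℝ (Set.range fun j : Fin k => c (Fin.natAdd m j))) N
      (fun j => c (Fin.natAdd m j)) (fun j => d (Fin.natAdd m j))
      fun j => ν (Fin.natAdd m j) where
  orthonormal_left := h.orthonormal_left.comp _ (Fin.natAdd_injective k m)
  span_left := rfl
  orthonormal_right := h.orthonormal_right.comp _ (Fin.natAdd_injective k m)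
  mem_right _ := h.mem_right _
  nonneg _ := h.nonneg _
  antitone _ _ hij := h.antitone (by simpa using hij)
  inner_eq _ := h.inner_eq _

/-- The sum of the `k` largest principal angles satisfies the triangle inequality. The angles between
`L` and `N` are computed on the span `U` of the last `k` principal vectors of `L`; along the
geodesic from `M` to `N` the angles to `U` grow at most by the `k` largest angles between `M`
and `N`, and those between `U` and `M` are bounded by interlacing. -/
theorem sum_natAdd_arccos_le_add [FiniteDimensional ℝ E] {m k : ℕ} {L M N : Submodule ℝ E}
    {e f a b c d : Fin (m + k) → E} {σ μ ν : Fin (m + k) → ℝ}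
    (hLM : IsPrincipalSystem L M e f σ) (hMN : IsPrincipalSystem M N a b μ)
    (hLN : IsPrincipalSystem L N c d ν) (hN : Module.finrank ℝ N = m + k) :
    ∑ j, Real.arccos (ν (Fin.natAdd m j)) ≤
      ∑ j, Real.arccos (σ (Fin.natAdd m j)) + ∑ j, Real.arccos (μ (Fin.natAdd m j)) := by
  have hU := hLN.natAdd
  set U := Submodule.span ℝ (Set.range fun j : Fin k => c (Fin.natAdd m j))
  have hUL : U ≤ L := by
    refine Submodule.span_le.2 ?_
    rintro _ ⟨j, rfl⟩
    exact hLN.mem_left _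
  obtain ⟨F, G, hF0, hF1, hF, hFG, hG, hG1, hstep⟩ := hMN.exists_geodesic_frame
  have hex : ∀ t, ∃ (x y : Fin k → E) (τ : Fin k → ℝ),
      IsPrincipalSystem U (Submodule.span ℝ (Set.range (F t))) x y τ := fun t =>
    exists_isPrincipalSystem U _ hU.finrank_left (by
      rw [finrank_span_eq_card (hF t).linearIndependent, Fintype.card_fin]
      omega)
  choose x y τ hτ using hex
  have h0 : ∀ j, σ (Fin.natAdd m j) ≤ τ 0 j := by
    have := hτ 0
    rw [hF0, hMN.span_left] at this
    exact this.le_of_le hLM hUL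
  have h1 : ∀ j, τ 1 j = ν (Fin.natAdd m j) := by
    have := hτ 1
    rw [hF1, (hMN.symm hN).span_left] at this
    exact congrFun (this.unique hU)
  have hmono : Monotone fun i => Real.arccos (μ i) := fun i j hij =>
    Real.arccos_le_arccos (hMN.antitone hij)
  have hρ : ∀ ρ ∈ Set.Ico (0 : ℝ) 1, ∑ j, Real.arccos (ρ * ν (Fin.natAdd m j)) ≤
      ∑ j, Real.arccos (ρ * σ (Fin.natAdd m j)) + ∑ j, Real.arccos (μ (Fin.natAdd m j)) := by
    rintro ρ ⟨hρ0, hρ1⟩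
    have h2 := le_add_of_forall_step_le (S := fun t => ∑ j, Real.arccos (ρ * τ t j))
      fun t s hs => sum_arccos_le_add (hF t) (hFG t) (hG t) (hG1 t) (hF (t + s)) hmono
        (fun i => Real.arccos_nonneg _) hs (hstep t s) (hτ t) (hτ (t + s)) hρ0 hρ1
    simp only [h1] at h2
    refine h2.trans (add_le_add_left (Finset.sum_le_sum fun j _ => ?_) _)
    exact Real.arccos_le_arccos (mul_le_mul_of_nonneg_left (h0 j) hρ0)
  have hcont : ∀ z : Fin (m + k) → ℝ, Filter.Tendsto
      (fun ρ : ℝ => ∑ j, Real.arccos (ρ * z (Fin.natAdd m j))) (nhdsWithin 1 (Set.Iio 1))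
      (nhds (∑ j, Real.arccos (z (Fin.natAdd m j)))) := fun z => by
    have : Continuous fun ρ : ℝ => ∑ j, Real.arccos (ρ * z (Fin.natAdd m j)) :=
      continuous_finsetSum _ fun j _ => Real.continuous_arccos.comp (by fun_prop)
    simpa using (this.tendsto 1).mono_left nhdsWithin_le_nhds
  refine le_of_tendsto_of_tendsto (hcont ν) ((hcont σ).add_const _) ?_
  filter_upwards [Ico_mem_nhdsLT (zero_lt_one' ℝ)] with ρ h
  exact hρ ρ h

end IsPrincipalSystem

end

/-! ### The angles between points of the Grassmannian -/

namespace Gr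

variable {p q : ℕ}

theorem span_range_coe {L : Gr p q} (e : OrthonormalBasis (Fin p) ℝ L.1) :
    Submodule.span ℝ (Set.range fun j => (e j : Ambient p q)) = L.1 := by
  have := congrArg (Submodule.map L.1.subtype) e.toBasis.span_eq
  rw [Submodule.map_span, ← Set.range_comp, Submodule.map_subtype_top] at this
  simpa [Function.comp_def] using this

/-- The matrix `crossGram e f` represents the orthogonal projection from `M` to `L`. -/
theorem inner_toEuclideanLin_crossGram {L M : Gr p q} (e : OrthonormalBasis (Fin p) ℝ L.1)
    (f : OrthonormalBasis (Fin p) ℝ M.1) (z : EuclideanSpace ℝ (Fin p)) (w : L.1) :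
    inner ℝ (Matrix.toEuclideanLin (crossGram e f) z) (e.repr w) =
      inner ℝ (f.repr.symm z : Ambient p q) (w : Ambient p q) := by
  have hz : (f.repr.symm z : Ambient p q) = ∑ j, z j • (f j : Ambient p q) := by
    rw [← f.sum_repr_symm]
    simp
  have hw : (w : Ambient p q) = ∑ i, e.repr w i • (e i : Ambient p q) := by
    conv_lhs => rw [← e.sum_repr w]
    simp
  rw [PiLp.inner_apply, hz, hw, inner_sum]
  refine Finset.sum_congr rfl fun i _ => ?_
  rw [real_inner_smul_right, sum_inner]
  simp only [real_inner_smul_left, Matrix.toLpLin_apply, Matrix.mulVec, dotProduct, crossGram,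
    Matrix.of_apply, RCLike.inner_apply, conj_trivial]
  congr 1
  refine Finset.sum_congr rfl fun j _ => ?_
  rw [real_inner_comm, mul_comm]

theorem exists_isPrincipalSystem_lam (L M : Gr p q) :
    ∃ x y, IsPrincipalSystem L.1 M.1 x y (lam L M) := by
  obtain ⟨v, u, hu, h⟩ := (Matrix.toEuclideanLin (crossGram L.onb M.onb)
    ).exists_orthonormal_apply_eq_singularValues_smul (k := p) (by simp) (by simp)
  refine ⟨fun j => L.onb.repr.symm (u j), fun j => M.onb.repr.symm (v j),
    IsPrincipalSystem.symm (U := M.1) ?_ L.2⟩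
  exact
    { orthonormal_left := (v.map M.onb.repr.symm).orthonormal.comp_linearIsometry M.1.subtypeₗᵢ
      span_left := by simpa using span_range_coe (v.map M.onb.repr.symm)
      orthonormal_right := (hu.comp_linearIsometry
        L.onb.repr.symm.toLinearIsometry).comp_linearIsometry L.1.subtypeₗᵢ
      mem_right := fun j => (L.onb.repr.symm (u j)).2
      nonneg := fun j => LinearMap.singularValues_nonneg _ _
      antitone := fun i j hij => LinearMap.singularValues_antitone _ hij
      inner_eq := fun j w hw => by
        have := inner_toEuclideanLin_crossGram L.onb M.onb (v j) ⟨w, hw⟩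
        rw [← this, h, real_inner_smul_left]
        congr 1
        conv_lhs => rw [← L.onb.repr.apply_symm_apply (u j), LinearIsometryEquiv.inner_map_map]
        rfl }

theorem lam_eq_of_isPrincipalSystem {L M : Gr p q} {x y : Fin p → Ambient p q} {τ : Fin p → ℝ}
    (h : IsPrincipalSystem L.1 M.1 x y τ) : lam L M = τ := by
  obtain ⟨_, _, h'⟩ := exists_isPrincipalSystem_lam L M
  exact h'.unique h

theorem lam_comm (L M : Gr p q) : lam L M = lam M L := by
  obtain ⟨_, _, h⟩ := exists_isPrincipalSystem_lam M L
  exact lam_eq_of_isPrincipalSystem (h.symm L.2)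

theorem lam_self (L : Gr p q) : lam L L = fun _ => 1 := by
  have ho : Orthonormal ℝ fun j => (L.onb j : Ambient p q) :=
    L.onb.orthonormal.comp_linearIsometry L.1.subtypeₗᵢ
  refine lam_eq_of_isPrincipalSystem
    { orthonormal_left := ho
      span_left := span_range_coe L.onb
      orthonormal_right := ho
      mem_right := fun j => (L.onb j).2
      nonneg := fun _ => zero_le_one
      antitone := antitone_const
      inner_eq := fun j v _ => ?_ }
  rw [one_mul]

theorem eq_of_lam_eq_one {L M : Gr p q} (h : lam L M = fun _ => 1) : L = M := by
  obtain ⟨x, y, hs⟩ := exists_isPrincipalSystem_lam L M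
  have hxy : x = y := funext fun j => by
    have := hs.inner_left_right j j
    rw [if_pos rfl, h] at this
    exact (inner_eq_one_iff_of_norm_eq_one (hs.orthonormal_left.1 j)
      (hs.orthonormal_right.1 j)).1 this
  refine Subtype.ext ?_
  rw [← hs.span_left, hxy, (hs.symm M.2).span_left]

theorem lam_act (g : OrthogonalGroup p q) (L M : Gr p q) :
    lam (act g L) (act g M) = lam L M := by
  obtain ⟨x, y, h⟩ := exists_isPrincipalSystem_lam L M
  refine lam_eq_of_isPrincipalSystem (x := fun j => g (x j)) (y := fun j => g (y j))
    { orthonormal_left := h.orthonormal_left.comp_linearIsometry g.toLinearIsometry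
      span_left := ?_
      orthonormal_right := h.orthonormal_right.comp_linearIsometry g.toLinearIsometry
      mem_right := fun j => Submodule.mem_map_of_mem (h.mem_right j)
      nonneg := h.nonneg
      antitone := h.antitone
      inner_eq := ?_ }
  · have := congrArg (Submodule.map (g.toLinearEquiv : Ambient p q →ₗ[ℝ] Ambient p q)) h.span_left
    rw [Submodule.map_span, ← Set.range_comp] at this
    exact this
  · rintro j _ ⟨v, hv, rfl⟩
    exact (g.inner_map_map _ _).trans ((h.inner_eq j v hv).trans
      (congrArg _ (g.inner_map_map _ _).symm))

theorem lam_mem_Icc (L M : Gr p q) (j : Fin p) : lam L M j ∈ Set.Icc (0 : ℝ) 1 := by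
  obtain ⟨_, _, h⟩ := exists_isPrincipalSystem_lam L M
  exact ⟨h.nonneg j, h.le_one j⟩

theorem angles_monotone (L M : Gr p q) : Monotone (angles L M) := fun i j hij => by
  obtain ⟨_, _, h⟩ := exists_isPrincipalSystem_lam L M
  exact Real.arccos_le_arccos (h.antitone hij)

theorem angles_eq_zero_iff {L M : Gr p q} : angles L M = 0 ↔ L = M := by
  constructor
  · intro h
    refine eq_of_lam_eq_one (funext fun j => ?_)
    have := Real.arccos_eq_zero.1 (congrFun h j)
    exact le_antisymm (lam_mem_Icc L M j).2 this
  · rintro rfl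
    funext j
    simp [angles, lam_self]

theorem tail_sum_angles_le (L M N : Gr p q) (m : ℕ) :
    (∑ j : Fin p, if m ≤ (j : ℕ) then angles L N j else 0) ≤
      ∑ j : Fin p, if m ≤ (j : ℕ) then (angles L M + angles M N) j else 0 := by
  rcases le_total p m with hm | hm
  · have hj : ∀ j : Fin p, ¬ m ≤ (j : ℕ) := fun j => by omega
    simp [hj]
  · obtain ⟨k, rfl⟩ := Nat.exists_eq_add_of_le hm
    obtain ⟨_, _, h₁⟩ := exists_isPrincipalSystem_lam L M
    obtain ⟨_, _, h₂⟩ := exists_isPrincipalSystem_lam M N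
    obtain ⟨_, _, h₃⟩ := exists_isPrincipalSystem_lam L N
    have hj : ∀ j : Fin m, ¬ m ≤ (j : ℕ) := fun j => by omega
    simpa [Fin.sum_univ_add, hj, Finset.sum_add_distrib, angles] using
      h₁.sum_natAdd_arccos_le_add h₂ h₃ N.2

end Gr

theorem theoremA (p q : ℕ) (hp : 0 < p) (hpq : p ≤ q)
    (ℓ : Seminorm ℝ (Fin p → ℝ)) (hℓ : ∀ x, ℓ x = 0 → x = 0)
    (hW : ∀ w ∈ weylGroup p, ∀ x, ℓ (w x) = ℓ x) :
    (∃ m : MetricSpace (Gr p q), ∀ L M : Gr p q, m.dist L M = ℓ (Gr.angles L M)) ∧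
      ∀ (g : Gr.OrthogonalGroup p q) (L M : Gr p q),
        ℓ (Gr.angles (Gr.act g L) (Gr.act g M)) = ℓ (Gr.angles L M) := by
  refine ⟨⟨{ dist := fun L M => ℓ (Gr.angles L M)
             dist_self := fun L => ?_
             dist_comm := fun L M => ?_
             dist_triangle := fun L M N => ?_
             eq_of_dist_eq_zero := fun {L M} h => Gr.angles_eq_zero_iff.1 (hℓ _ h) },
    fun _ _ => rfl⟩, fun g L M => ?_⟩
  · rw [Gr.angles_eq_zero_iff.2 rfl, map_zero]
  · unfold Gr.angles
    rw [Gr.lam_comm]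
  · exact (weylInvariant_le_of_tail_sums_le ℓ hW _ _ (Gr.angles_monotone L N)
      (fun _ => Real.arccos_nonneg _) (Gr.tail_sum_angles_le L M N)).trans (map_add_le_add ℓ _ _)
  · unfold Gr.angles
    rw [Gr.lam_act]
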